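/- Let $S$ be a nonsingular irreducible projective surface over $\mathbb{C}$ with an ample line bundle $\mathcal{O}_S(1)$. For a coherent sheaf $E$ on $S$ let $\operatorname{rk}(E)$ be its rank (at the generic point) and $P_E\in\mathbb{Q}[m]$ its Hilbert polynomial, $P_E(m)=\chi(E(m))$. For $p,p'\in\mathbb{Q}[m]$ write $p<p'$ if $p(m)<p'(m)$ for all $m\gg 0$. A triple $T=(E_1,E_2,\phi)$ consists of coherent sheaves $E_1,E_2$ on $S$ and a morphism $\phi:E_1\to E_2$; it is torsion-free if $E_1$ and $E_2$ are. A subtriple $T'=(E_1',E_2',\phi')$ of $T$ consists of coherent subsheaves $E_i'\subset E_i$ with $\phi(E_1')\subset E_2'$ and $\phi'=\phi|_{E_1'}$; it is nontrivial if it is neither zero nor equal to $T$. Put $r_i=\operatorname{rk}(E_i)$, $r_i'=\operatorname{rk}(E_i')$. (For torsion-free $T$ every nontrivial subtriple has $r_1'+r_2'>0$.) Let $q,q',\sigma\in\mathbb{Q}[m]$. * $T$ is $q'$-stable (for $r_1>0$) if for every nontrivial subtriple $T'$ $$\Theta_{q'}(T')=\Big(\frac{P_{E_1'}+P_{E_2'}}{r_1'+r_2'}-q'\Big)-\frac{r_1'}{r_1'+r_2'}\cdot\frac{r_1+r_2}{r_1}\Big(\frac{P_{E_1}+P_{E_2}}{r_1+r_2}-q'\Big)<0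 .$$ * $T$ is $\sigma$-stable if $\mu_\sigma(T')<\mu_\sigma(T)$ for every nontrivial subtriple $T'$, where $\mu_\sigma(T)=\dfrac{P_{E_1}+P_{E_2}+r_1\sigma}{r_1+r_2}$. * $T$ is $q$-stable if for every nontrivial subtriple $T'$ $$r_2\,q\,\big(r_1P_{E_1'}-r_1'P_{E_1}+r_1'q\big)+r_1\,q\,\big(r_2P_{E_2'}-r_2'P_{E_2}-r_2'q\big)<0 .$$ **Proposition.** Let $T=(E_1,E_2,\phi)$ be a torsion-free triple with $r_1>0$, and let $q',\sigma$ be related by $$\sigma=\frac{r_1+r_2}{r_1}\Big(q'-\frac{P_{E_1}+P_{E_2}}{r_1+r_2}\Big).$$ Then $T$ is $q'$-stable if and only if it is $\sigma$-stable. Moreover, if $r_2>0$ and $q'=\dfrac{P_{E_2}+q}{r_2}$ for a polynomial $q$ with positive leading coefficient, then $T$ is $q$-stable if and only if it is $\sigma$-stable. -/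

import Mathlib

open CategoryTheory AlgebraicGeometry TopologicalSpace Polynomial

noncomputable section

namespace HolomorphicTriples

/-! ### Sheaves of modules on a scheme: tensor product, coherence, rank, torsion -/

section Sheaves

/-- The tensor product `M ⊗ N` of two `𝒪_X`-modules: the sheafification of
`U ↦ M(U) ⊗_{𝒪(U)} N(U)`. -/
def tensor {X : Scheme.{0}} (M N : X.Modules) : X.Modules :=
  (PresheafOfModules.sheafification (𝟙 X.ringCatSheaf.obj)).obj
    (PresheafOfModules.Monoidal.tensorObj (R := X.presheaf) M.val N.val)

/-- The twist `M ⊗ L^{⊗ n}`, for `n ≥ 0`. -/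
def twist {X : Scheme.{0}} (L M : X.Modules) : ℕ → X.Modules
  | 0 => M
  | n + 1 => tensor (twist L M n) L

/-- `L` is an invertible sheaf (a line bundle): locally isomorphic to the structure sheaf. -/
def IsInvertible {X : Scheme.{0}} (L : X.Modules) : Prop :=
  ∀ x : X, ∃ U : X.Opens, x ∈ U ∧
    Nonempty (L.restrict U.ι ≅ SheafOfModules.unit (U : Scheme.{0}).ringCatSheaf)

/-- Coherent sheaves on a locally noetherian scheme: quasi-coherent sheaves whose module of
sections over every affine open set is finitely generated. -/
structure IsCoherent {X : Scheme.{0}} (M : X.Modules) : Prop where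
  quasicoherent : SheafOfModules.IsQuasicoherent M
  finite : ∀ U : X.Opens, IsAffineOpen U →
    Module.Finite (X.presheaf.obj (.op U)) (M.presheaf.obj (.op U))

/-- `L` is ample: for every coherent `F`, the sheaf `F ⊗ L^{⊗ n}` is generated by its global
sections for all large `n`. -/
def IsAmple {X : Scheme.{0}} (L : X.Modules) : Prop :=
  ∀ F : X.Modules, IsCoherent F →
    ∃ n₀ : ℕ, ∀ n ≥ n₀, Nonempty (SheafOfModules.GeneratingSections (twist L F n))

/-- The stalk of a presheaf of modules is a module over the stalk of the presheaf of rings. -/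
@[reducible] def presheafStalkModule {X : TopCat.{0}} {R : X.Presheaf CommRingCat.{0}}
    (M : PresheafOfModules.{0} (R ⋙ forget₂ _ _)) (x : X) :
    Module (R.stalk x) ↑(TopCat.Presheaf.stalk (C := Ab.{0}) M.presheaf x) :=
  inferInstance

/-- The stalk of an `𝒪_X`-module at `x`. -/
def stalk {X : Scheme.{0}} (M : X.Modules) (x : X) : Ab.{0} :=
  TopCat.Presheaf.stalk (C := Ab.{0}) M.presheaf x

/-- The stalk of an `𝒪_X`-module at `x` is a module over the local ring `𝒪_{X,x}`. -/
instance stalkModule {X : Scheme.{0}} (M : X.Modules) (x : X) :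
    Module (X.presheaf.stalk x) (stalk M x) :=
  presheafStalkModule (R := X.presheaf) M.val x

/-- The rank of a sheaf on an integral scheme: the dimension of the stalk at the generic point
over the function field. -/
def rank {X : Scheme.{0}} [IsIntegral X] (M : X.Modules) : ℕ :=
  Module.finrank (X.presheaf.stalk (genericPoint X)) (stalk M (genericPoint X))

/-- A sheaf on an integral scheme is torsion-free if no nonzero section is killed by a nonzero
function. -/
def IsTorsionFree {X : Scheme.{0}} (M : X.Modules) : Prop :=
  ∀ (U : X.Opens) (f : X.presheaf.obj (.op U)) (s : M.presheaf.obj (.op U)),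
    f ≠ 0 → f • s = 0 → s = 0

end Sheaves

/-! ### Cohomology and Euler characteristics over `ℂ` -/

section Cohomology

variable {X : Scheme.{0}} (π : X ⟶ Spec (CommRingCat.of ℂ))

/-- The ring homomorphism `ℂ → Γ(X, 𝒪_X)` of a `ℂ`-scheme. -/
def scalars : ℂ →+* X.ringCatSheaf.obj.obj (.op ⊤) :=
  ((Scheme.ΓSpecIso (CommRingCat.of ℂ)).inv ≫ π.appTop).hom

/-- The sheaf of `Γ(X, 𝒪_X)`-modules underlying an `𝒪_X`-module. -/
def toModuleSheaf (X : Scheme.{0}) :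
    X.Modules ⥤ Sheaf (Opens.grothendieckTopology X)
      (ModuleCat.{0} (X.ringCatSheaf.obj.obj (.op ⊤))) :=
  SheafOfModules.forgetToSheafModuleCat X.ringCatSheaf (.op ⊤)
    (Limits.initialOpOfTerminal Limits.isTerminalTop)

/-- The sheaf of `ℂ`-vector spaces underlying an `𝒪_X`-module. -/
def toVectSheaf : X.Modules ⥤ TopCat.Sheaf (ModuleCat.{0} ℂ) X :=
  toModuleSheaf X ⋙ sheafCompose (Opens.grothendieckTopology X)
    (ModuleCat.restrictScalars.{0} (scalars π))

/-- Global sections of sheaves of `ℂ`-vector spaces. -/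
def globalSections (X : TopCat.{0}) : TopCat.Sheaf (ModuleCat.{0} ℂ) X ⥤ ModuleCat.{0} ℂ :=
  TopCat.Sheaf.forget _ _ ⋙ (evaluation _ _).obj (.op ⊤)

instance (X : TopCat.{0}) : (globalSections X).Additive where
  map_add := rfl

/-- Sheaf cohomology `H^i(X, M)`, a complex vector space: the right derived functors of global
sections. -/
def cohomology (M : X.Modules) (i : ℕ) : ModuleCat.{0} ℂ :=
  ((globalSections X).rightDerived i).obj ((toVectSheaf π).obj M)

/-- The Euler characteristic `χ(M) = h⁰(M) - h¹(M) + h²(M)` of a coherent sheaf on a projective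
surface; all higher cohomology vanishes because the dimension is `2`. -/
def eulerChar (M : X.Modules) : ℤ :=
  ∑ i ∈ Finset.range 3, (-1) ^ i * (Module.finrank ℂ (cohomology π M i) : ℤ)

open Classical in
/-- The Hilbert polynomial of `M` with respect to `L`: the (unique) polynomial `P` with rational
coefficients such that `P(m) = χ(M ⊗ L^{⊗ m})` for all `m ≥ 0`. For a coherent sheaf on a
projective surface such a polynomial exists by the theorem of Snapper and Kleiman, so that the
value `0` of the second branch is never used. -/
def hilbertPoly (L M : X.Modules) : ℚ[X] :=
  if h : ∃ P : ℚ[X], ∀ m : ℕ, P.eval (m : ℚ) = (eulerChar π (twist L M m) : ℚ) then h.choose else 0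

end Cohomology

/-- A nonsingular projective (irreducible) surface over `ℂ` with an ample line bundle `𝒪_S(1)`.
A proper `ℂ`-scheme with an ample line bundle is projective. -/
structure PolarizedSurface where
  S : Scheme.{0}
  π : S ⟶ Spec (CommRingCat.of ℂ)
  integral : IsIntegral S
  proper : IsProper π
  smooth : SmoothOfRelativeDimension 2 π
  O1 : S.Modules
  invertible : IsInvertible O1
  ample : IsAmple O1

attribute [instance] PolarizedSurface.integral

variable {X : PolarizedSurface}

/-- The Hilbert polynomial `P_E` of a sheaf on a polarized surface. -/
def PolarizedSurface.P (X : PolarizedSurface) (E : X.S.Modules) : ℚ[X] :=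
  hilbertPoly X.π X.O1 E

/-- The order on polynomials: `p < p'` if `p(m) < p'(m)` for all `m ≫ 0`. -/
def PolyLT (p p' : ℚ[X]) : Prop :=
  ∀ᶠ m : ℕ in Filter.atTop, p.eval (m : ℚ) < p'.eval (m : ℚ)

/-- A holomorphic triple: two coherent sheaves and a morphism between them. -/
structure Triple (X : PolarizedSurface) where
  E₁ : X.S.Modules
  E₂ : X.S.Modules
  φ : E₁ ⟶ E₂
  coherent₁ : IsCoherent E₁
  coherent₂ : IsCoherent E₂

namespace Triple

/-- Torsion-free triples. -/
def TorsionFree (T : Triple X) : Prop :=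
  IsTorsionFree T.E₁ ∧ IsTorsionFree T.E₂

/-- The rank `r₁` of `E₁`, as a rational number. -/
def r₁ (T : Triple X) : ℚ := rank T.E₁

/-- The rank `r₂` of `E₂`, as a rational number. -/
def r₂ (T : Triple X) : ℚ := rank T.E₂

/-- The Hilbert polynomial `P_{E₁}`. -/
def P₁ (T : Triple X) : ℚ[X] := X.P T.E₁

/-- The Hilbert polynomial `P_{E₂}`. -/
def P₂ (T : Triple X) : ℚ[X] := X.P T.E₂

/-- A subtriple `T' = (E₁', E₂', φ')` of `T`: a morphism of triples into `T` both of whose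
components are inclusions of subsheaves. -/
structure Subtriple (T : Triple X) where
  T' : Triple X
  i₁ : T'.E₁ ⟶ T.E₁
  i₂ : T'.E₂ ⟶ T.E₂
  mono₁ : Mono i₁
  mono₂ : Mono i₂
  comm : T'.φ ≫ i₂ = i₁ ≫ T.φ

/-- A subtriple is nontrivial if it is neither zero nor the whole triple. -/
def Subtriple.Nontrivial {T : Triple X} (A : T.Subtriple) : Prop :=
  ¬ (Limits.IsZero A.T'.E₁ ∧ Limits.IsZero A.T'.E₂) ∧ ¬ (IsIso A.i₁ ∧ IsIso A.i₂)

/-- `(q₁, q₂)`-stability. -/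
def IsQStable (T : Triple X) (q₁ q₂ : ℚ[X]) : Prop :=
  ∀ A : T.Subtriple, A.Nontrivial →
    PolyLT
      (T.r₂ • q₂ * (T.r₁ • A.T'.P₁ - A.T'.r₁ • T.P₁ + A.T'.r₁ • q₁) +
        T.r₁ • q₁ * (T.r₂ • A.T'.P₂ - A.T'.r₂ • T.P₂ - A.T'.r₂ • q₂)) 0

/-- The function `Θ_{q'}(T')` of a subtriple `T'` of `T`. -/
def Θ (T : Triple X) (q' : ℚ[X]) (T' : Triple X) : ℚ[X] :=
  ((1 / (T'.r₁ + T'.r₂)) • (T'.P₁ + T'.P₂) - q') -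
    (T'.r₁ / (T'.r₁ + T'.r₂) * ((T.r₁ + T.r₂) / T.r₁)) •
      ((1 / (T.r₁ + T.r₂)) • (T.P₁ + T.P₂) - q')

/-- `q'`-stability. -/
def IsQPrimeStable (T : Triple X) (q' : ℚ[X]) : Prop :=
  ∀ A : T.Subtriple, A.Nontrivial → PolyLT (T.Θ q' A.T') 0

/-- The `σ`-polynomial `P_σ(T) = P_{E₁} + P_{E₂} + r₁ σ`. -/
def sigmaPoly (T : Triple X) (σ : ℚ[X]) : ℚ[X] :=
  T.P₁ + T.P₂ + T.r₁ • σ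

/-- The `σ`-slope `μ_σ(T) = P_σ(T) / (r₁ + r₂)`. -/
def sigmaSlope (T : Triple X) (σ : ℚ[X]) : ℚ[X] :=
  (1 / (T.r₁ + T.r₂)) • T.sigmaPoly σ

/-- `σ`-stability. -/
def IsSigmaStable (T : Triple X) (σ : ℚ[X]) : Prop :=
  ∀ A : T.Subtriple, A.Nontrivial → PolyLT (A.T'.sigmaSlope σ) (T.sigmaSlope σ)

end Triple

end HolomorphicTriples

end

/-!
With `σ = ((r₁ + r₂) / r₁) (q' - (P₁ + P₂) / (r₁ + r₂))` the `σ`-slope of `T` is `q'`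
(`Triple.sigmaSlope_eq`), and then `Θ_{q'}(T') = μ_σ(T') - q'` for every `T'` (`Triple.Θ_eq`), so that
`q'`-stability and `σ`-stability are the same inequality for each subtriple. If moreover
`r₂ q' = P₂ + q`, the polynomial in the definition of `q`-stability is
`r₁ r₂ (r₁' + r₂') q (μ_σ(T') - q')` (`Triple.qStability_eq`). As `q` has positive leading
coefficient, its values are eventually positive, and the two conditions agree once
`r₁' + r₂' > 0`.


That last inequality (`Triple.Subtriple.rank_pos`) is the geometric input. A subsheaf of a
torsion-free sheaf is torsion-free, so it suffices that a torsion-free coherent sheaf of rank `0` is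
zero (`isZero_of_torsionFree_of_rank_eq_zero`). Both steps of the proof use that, over an affine
open set, restricting a quasi-coherent sheaf to `D(f)` is localization at `f`: the stalk at the
generic point is then finite-dimensional over the function field (`finite_stalk`), so that rank `0`
makes it zero, and a section with zero germ there is killed by a power of some `f ≠ 0`.
-/

namespace HolomorphicTriples

/-! ### Sections of quasi-coherent sheaves over basic open sets -/

/-- On `Spec R`, restriction of a quasi-coherent sheaf to `D(f)` is localization at `f`. The open
set is a variable `D` equal to `D(f)`, so that it has the type of an open set of the scheme. -/
theorem isLocalizedModule_res {R : CommRingCat.{0}} {M : (Spec R).Modules}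
    (hM : SheafOfModules.IsQuasicoherent M) (f : R) {D : (Spec R).Opens}
    (hD : D = PrimeSpectrum.basicOpen f) :
    IsLocalizedModule (.powers f) ((modulesSpecToSheaf.obj M).obj.map D.leTop.op).hom := by
  subst hD
  exact (isIso_fromTildeΓ_iff_isLocalizing M).mp
    (Scheme.Modules.isIso_fromTildeΓ_of_isQuasicoherent M) f

theorem exists_res_eq_pow_smul_Spec {R : CommRingCat.{0}} {M : (Spec R).Modules}
    (hM : SheafOfModules.IsQuasicoherent M) (f : R) {D : (Spec R).Opens}
    (hD : D = PrimeSpectrum.basicOpen f) (s : Γ(M, D)) :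
    ∃ (n : ℕ) (t : Γ(M, ⊤)), M.presheaf.map D.leTop.op t =
      (Spec R).presheaf.map D.leTop.op ((Scheme.ΓSpecIso R).inv (f ^ n)) • s := by
  have := isLocalizedModule_res hM f hD
  obtain ⟨⟨t, ⟨_, n, rfl⟩⟩, ht⟩ := IsLocalizedModule.surj (.powers f)
    ((modulesSpecToSheaf.obj M).obj.map D.leTop.op).hom s
  exact ⟨n, t, ht.symm⟩

theorem exists_pow_smul_eq_zero_Spec {R : CommRingCat.{0}} {M : (Spec R).Modules}
    (hM : SheafOfModules.IsQuasicoherent M) (f : R) {D : (Spec R).Opens}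
    (hD : D = PrimeSpectrum.basicOpen f) (t : Γ(M, ⊤))
    (ht : M.presheaf.map D.leTop.op t = 0) :
    ∃ n : ℕ, (Scheme.ΓSpecIso R).inv (f ^ n) • t = 0 := by
  have := isLocalizedModule_res hM f hD
  obtain ⟨⟨_, n, rfl⟩, hn⟩ := (IsLocalizedModule.eq_zero_iff (.powers f)
    ((modulesSpecToSheaf.obj M).obj.map D.leTop.op).hom).mp ht
  refine ⟨n, ?_⟩
  have h : (f ^ n • t : Γ(M, ⊤)) = 0 := hn
  rw [Scheme.Modules.smul_Spec_def] at h
  have e : (Opens.leTop (⊤ : (Spec R).Opens)).op = 𝟙 _ := rfl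
  rw [e, (Spec R).presheaf.map_id] at h
  exact h

/-- The function `f` on `Spec R`, moved to the image of an open immersion `j`, is the `g` that pulls
back to it. -/
theorem appIso_inv_ΓSpecIso_inv {X : Scheme.{0}} {R : CommRingCat.{0}}
    (j : Spec R ⟶ X) [IsOpenImmersion j] (f : R) (g : Γ(X, j ''ᵁ ⊤))
    (hg : j.app _ g = (Spec R).presheaf.map (Opens.leTop _).op ((Scheme.ΓSpecIso R).inv f)) :
    (j.appIso ⊤).inv ((Scheme.ΓSpecIso R).inv f) = g := by
  have : (j.appIso ⊤).hom g = (Scheme.ΓSpecIso R).inv f := by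
    rw [Scheme.Hom.appIso_hom, CommRingCat.comp_apply, hg, ← CommRingCat.comp_apply,
      ← Functor.map_comp]
    have : ∀ i : Opposite.op (⊤ : (Spec R).Opens) ⟶ Opposite.op ⊤,
      (Spec R).presheaf.map i = 𝟙 _ := fun i ↦ (Spec R).presheaf.map_id _
    rw [this]
    rfl
  rw [← this]; simp

/-- `exists_res_eq_pow_smul_Spec` for the image of an open immersion `j : Spec R ⟶ X`. The images
are variables `U` and `V`, which spares the transport of sections along equalities of open sets when
`j` is the inclusion of an affine open set. -/
theorem exists_res_eq_pow_smul_of_immersion {X : Scheme.{0}} {R : CommRingCat.{0}}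
    (j : Spec R ⟶ X) [IsOpenImmersion j]
    {M : X.Modules} (hM : SheafOfModules.IsQuasicoherent M) (f : R) {D : (Spec R).Opens}
    (hD : D = PrimeSpectrum.basicOpen f) {U V : X.Opens} (hU : j ''ᵁ ⊤ = U) (hV : j ''ᵁ D = V)
    (hVU : V ≤ U) (g : Γ(X, U))
    (hg : j.app U g = (Spec R).presheaf.map (Opens.leTop _).op ((Scheme.ΓSpecIso R).inv f))
    (s : Γ(M, V)) :
    ∃ (n : ℕ) (t : Γ(M, U)), M.presheaf.map (homOfLE hVU).op t =
      X.presheaf.map (homOfLE hVU).op (g ^ n) • s := by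
  subst hU
  subst hV
  have hM' : SheafOfModules.IsQuasicoherent (M.restrict j) :=
    Scheme.Modules.isQuasicoherent_restrictFunctor j M
  obtain ⟨n, t, ht⟩ := exists_res_eq_pow_smul_Spec hM' f hD s
  refine ⟨n, t, ht.trans ?_⟩
  refine (Scheme.Modules.smul_restrictAppIso_hom_apply j M D _ s).trans ?_
  rw [← appIso_inv_ΓSpecIso_inv j f g hg, ← map_pow, ← map_pow, ← CommRingCat.comp_apply,
    Scheme.Hom.appIso_inv_naturality]
  rfl

theorem exists_pow_smul_eq_zero_of_immersion {X : Scheme.{0}} {R : CommRingCat.{0}}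
    (j : Spec R ⟶ X) [IsOpenImmersion j]
    {M : X.Modules} (hM : SheafOfModules.IsQuasicoherent M) (f : R) {D : (Spec R).Opens}
    (hD : D = PrimeSpectrum.basicOpen f) {U V : X.Opens} (hU : j ''ᵁ ⊤ = U) (hV : j ''ᵁ D = V)
    (hVU : V ≤ U) (g : Γ(X, U))
    (hg : j.app U g = (Spec R).presheaf.map (Opens.leTop _).op ((Scheme.ΓSpecIso R).inv f))
    (t : Γ(M, U)) (ht : M.presheaf.map (homOfLE hVU).op t = 0) :
    ∃ n : ℕ, g ^ n • t = 0 := by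
  subst hU
  subst hV
  have hM' : SheafOfModules.IsQuasicoherent (M.restrict j) :=
    Scheme.Modules.isQuasicoherent_restrictFunctor j M
  obtain ⟨n, hn⟩ := exists_pow_smul_eq_zero_Spec hM' f hD t ht
  refine ⟨n, Eq.trans ?_ hn⟩
  refine Eq.trans ?_ (Scheme.Modules.smul_restrictAppIso_hom_apply j M ⊤ _ t).symm
  rw [← appIso_inv_ΓSpecIso_inv j f g hg, ← map_pow, ← map_pow]
  rfl

/-- A section of a quasi-coherent sheaf over `D(f)` extends to the affine open set `U` after
multiplication by a power of `f`. -/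
theorem exists_res_basicOpen_eq_pow_smul {X : Scheme.{0}} {M : X.Modules}
    (hM : SheafOfModules.IsQuasicoherent M) {U : X.Opens} (hU : IsAffineOpen U) (f : Γ(X, U))
    (s : Γ(M, X.basicOpen f)) :
    ∃ (n : ℕ) (t : Γ(M, U)), M.presheaf.map (homOfLE (X.basicOpen_le f)).op t =
      X.presheaf.map (homOfLE (X.basicOpen_le f)).op (f ^ n) • s := by
  refine exists_res_eq_pow_smul_of_immersion hU.fromSpec hM f rfl ?_
    (hU.fromSpec_image_basicOpen f) _ f ?_ s
  · rw [Scheme.Hom.image_top_eq_opensRange, hU.opensRange_fromSpec]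
  · rw [hU.fromSpec_app_self]; rfl

/-- A section of a quasi-coherent sheaf over an affine open set which vanishes on `D(f)` is killed
by a power of `f`. -/
theorem exists_pow_smul_eq_zero_of_res_basicOpen {X : Scheme.{0}} {M : X.Modules}
    (hM : SheafOfModules.IsQuasicoherent M) {U : X.Opens} (hU : IsAffineOpen U) (f : Γ(X, U))
    (t : Γ(M, U)) (ht : M.presheaf.map (homOfLE (X.basicOpen_le f)).op t = 0) :
    ∃ n : ℕ, f ^ n • t = 0 := by
  refine exists_pow_smul_eq_zero_of_immersion hU.fromSpec hM f rfl ?_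
    (hU.fromSpec_image_basicOpen f) _ f ?_ t ht
  · rw [Scheme.Hom.image_top_eq_opensRange, hU.opensRange_fromSpec]
  · rw [hU.fromSpec_app_self]; rfl

/-! ### Stalks of coherent sheaves and vanishing of torsion-free sheaves of rank zero -/

/-- The germ at `x` of a section of `M`, with values in the stalk as an `𝒪_{X,x}`-module. -/
noncomputable def germ {X : Scheme.{0}} (M : X.Modules) {U : X.Opens} {x : X} (hx : x ∈ U) :
    Γ(M, U) →+ stalk M x :=
  (M.presheaf.germ U x hx).hom

theorem germ_smul {X : Scheme.{0}} (M : X.Modules) {U : X.Opens} {x : X} (hx : x ∈ U)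
    (a : Γ(X, U)) (m : Γ(M, U)) :
    germ M hx (a • m) = X.presheaf.germ U x hx a • germ M hx m :=
  PresheafOfModules.germ_smul (R := X.presheaf) M.val x U hx a m

theorem germ_res {X : Scheme.{0}} (M : X.Modules) {U V : X.Opens} (h : V ≤ U) {x : X} (hx : x ∈ V)
    (m : Γ(M, U)) : germ M hx (M.presheaf.map (homOfLE h).op m) = germ M (h hx) m :=
  M.presheaf.germ_res_apply (homOfLE h) x hx m

/-- The stalk is spanned by the germs of generators of `Γ(M, U)`, for any affine open set `U`
containing the point: some multiple of a given germ by a unit `f ^ n` comes from `Γ(M, U)`. -/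
theorem finite_stalk {X : Scheme.{0}} {M : X.Modules} (hM : IsCoherent M) (x : X) :
    Module.Finite (X.presheaf.stalk x) (stalk M x) := by
  obtain ⟨U, hU, hxU, -⟩ := exists_isAffineOpen_mem_and_subset (X := X) (x := x) (U := ⊤) trivial
  obtain ⟨S, hS⟩ := hM.finite U hU
  have hG : ∀ t : Γ(M, U), germ M hxU t ∈
      Submodule.span (X.presheaf.stalk x) (germ M hxU '' S) := by
    intro t
    have ht : t ∈ Submodule.span Γ(X, U) (S : Set Γ(M, U)) :=
      (congrArg (t ∈ ·) hS).mpr trivial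
    induction ht using Submodule.span_induction with
    | mem y hy => exact Submodule.subset_span ⟨y, hy, rfl⟩
    | zero => rw [map_zero]; exact Submodule.zero_mem _
    | add y z _ _ hy hz => rw [map_add]; exact Submodule.add_mem _ hy hz
    | smul a y _ hy => rw [germ_smul]; exact Submodule.smul_mem _ _ hy
  classical
  refine ⟨S.image (germ M hxU), ?_⟩
  rw [Finset.coe_image, eq_top_iff]
  rintro z -
  obtain ⟨V, hxV, s, hs⟩ := M.presheaf.exists_germ_eq z
  replace hs : germ M hxV s = z := hs
  obtain ⟨f, hfV, hxf⟩ := hU.exists_basicOpen_le ⟨x, hxV⟩ hxU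
  obtain ⟨n, t, ht⟩ := exists_res_basicOpen_eq_pow_smul hM.quasicoherent hU f
    (M.presheaf.map (homOfLE hfV).op s)
  have hu : IsUnit (X.presheaf.germ U x hxU (f ^ n)) := by
    rw [map_pow]; exact ((X.mem_basicOpen f x hxU).mp hxf).pow n
  have key : germ M hxU t = X.presheaf.germ U x hxU (f ^ n) • z := by
    have := congrArg (germ M hxf) ht
    rwa [germ_smul, germ_res, germ_res, hs, TopCat.Presheaf.germ_res_apply] at this
  rw [← Submodule.smul_mem_iff_of_isUnit _ hu, ← key]
  exact hG t

/-- A torsion-free coherent sheaf of rank `0` vanishes: its sections over an affine open set have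
zero germ at the generic point, hence vanish on some nonempty `D(f)`, hence are killed by a power of
`f ≠ 0`. -/
theorem isZero_of_torsionFree_of_rank_eq_zero {X : Scheme.{0}} [IsIntegral X] {M : X.Modules}
    (hM : IsCoherent M) (htf : IsTorsionFree M) (hr : rank M = 0) : Limits.IsZero M := by
  have hfin := finite_stalk hM (genericPoint X)
  -- `finrank = 0` would also hold for an infinite-dimensional stalk, which `hfin` excludes.
  have hsub : Subsingleton (stalk M (genericPoint X)) := by
    let _ : Field (X.presheaf.stalk (genericPoint X)) := inferInstanceAs (Field X.functionField)
    exact Module.finrank_zero_iff.mp hr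
  have hη {U : X.Opens} {x : X} (hx : x ∈ U) : genericPoint X ∈ U :=
    (genericPoint_specializes x).mem_open U.2 hx
  have haff (U : X.Opens) (hU : IsAffineOpen U) (x : X) (hx : x ∈ U) (s : Γ(M, U)) : s = 0 := by
    obtain ⟨V, hV, i, i', hs⟩ := M.presheaf.germ_eq _ (hη hx) (hη hx) s 0
      (hsub.elim (M.presheaf.germ U _ (hη hx) s) _)
    obtain ⟨f, hfV, hf⟩ := hU.exists_basicOpen_le ⟨_, hV⟩ (hη hx)
    obtain ⟨n, hn⟩ := exists_pow_smul_eq_zero_of_res_basicOpen hM.quasicoherent hU f s (by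
      have := congrArg (M.presheaf.map (homOfLE hfV).op) hs
      rw [map_zero, map_zero, ← ConcreteCategory.comp_apply, ← Functor.map_comp] at this
      exact this)
    refine htf U (f ^ n) s ?_ hn
    -- `f ^ n ≠ 0`, as its germ at the generic point is a unit.
    have hu : IsUnit (X.presheaf.germ U _ (hη hx) (f ^ n)) := by
      rw [map_pow]; exact ((X.mem_basicOpen f _ _).mp hf).pow n
    intro h0
    rw [h0, map_zero] at hu
    exact not_isUnit_zero hu
  rw [Limits.IsZero.iff_id_eq_zero]
  refine Scheme.Modules.hom_ext _ _ fun U ↦ ?_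
  ext s
  change s = 0
  refine M.isSheaf.section_ext fun x hx ↦ ?_
  obtain ⟨W, hW, hxW, hWU⟩ := exists_isAffineOpen_mem_and_subset (X := X) hx
  exact ⟨W, hWU, hxW, (haff W hW x hxW _).trans (haff W hW x hxW _).symm⟩

theorem IsTorsionFree.of_mono {X : Scheme.{0}} {M N : X.Modules} (i : M ⟶ N) [Mono i]
    (hN : IsTorsionFree N) : IsTorsionFree M := by
  intro U f s hf hs
  have : Mono i.mapPresheaf := inferInstanceAs (Mono ((Scheme.Modules.toPresheaf X).map i))
  have hinj : Function.Injective (i.app U) :=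
    (AddCommGrpCat.mono_iff_injective (i.mapPresheaf.app (.op U))).mp inferInstance
  refine hinj ((hN U f _ hf ?_).trans (map_zero _).symm)
  rw [← Scheme.Modules.Hom.app_smul]
  exact (congrArg _ hs).trans (map_zero _)

/-! ### Eventual signs of polynomials -/

theorem eventually_eval_pos {q : ℚ[X]} (hq : 0 < q.leadingCoeff) :
    ∀ᶠ m : ℕ in Filter.atTop, 0 < q.eval (m : ℚ) := by
  rcases Nat.eq_zero_or_pos q.natDegree with h | h
  · rw [eq_C_of_natDegree_eq_zero h] at hq ⊢
    exact .of_forall fun m ↦ by simpa using hq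
  · exact tendsto_natCast_atTop_atTop.eventually
      ((q.tendsto_atTop_of_leadingCoeff_nonneg
      (natDegree_pos_iff_degree_pos.mp h) hq.le).eventually_gt_atTop 0)

theorem polyLT_sub_zero_iff (p p' : ℚ[X]) : PolyLT (p - p') 0 ↔ PolyLT p p' := by
  simp [PolyLT]

theorem polyLT_smul_mul_zero_iff {c : ℚ} (hc : 0 < c) {q : ℚ[X]} (hq : 0 < q.leadingCoeff)
    (p : ℚ[X]) : PolyLT (c • (q * p)) 0 ↔ PolyLT p 0 := by
  refine Filter.eventually_congr ((eventually_eval_pos hq).mono fun m hm ↦ ?_)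
  simp only [eval_smul, eval_mul, eval_zero, smul_eq_mul]
  rw [← mul_assoc, ← smul_eq_mul, smul_neg_iff_of_pos_left (mul_pos hc hm)]

/-! ### Comparison of the three stability polynomials of a subtriple -/

variable {X : PolarizedSurface}

namespace Triple

theorem r₁_nonneg (T : Triple X) : 0 ≤ T.r₁ := Nat.cast_nonneg _

theorem r₂_nonneg (T : Triple X) : 0 ≤ T.r₂ := Nat.cast_nonneg _

/-- A nontrivial subtriple of a torsion-free triple has positive total rank. -/
theorem Subtriple.rank_pos {T : Triple X} (hT : T.TorsionFree) {A : T.Subtriple}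
    (hA : A.Nontrivial) : 0 < A.T'.r₁ + A.T'.r₂ := by
  have := A.mono₁
  have := A.mono₂
  by_contra h
  have h₁ : A.T'.r₁ = 0 := by linarith [A.T'.r₁_nonneg, A.T'.r₂_nonneg]
  have h₂ : A.T'.r₂ = 0 := by linarith [A.T'.r₁_nonneg, A.T'.r₂_nonneg]
  exact hA.1 ⟨isZero_of_torsionFree_of_rank_eq_zero A.T'.coherent₁ (hT.1.of_mono A.i₁)
      (Nat.cast_eq_zero.mp h₁),
    isZero_of_torsionFree_of_rank_eq_zero A.T'.coherent₂ (hT.2.of_mono A.i₂)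
      (Nat.cast_eq_zero.mp h₂)⟩

variable {T : Triple X} {q' σ : ℚ[X]}

/-- The parameter `σ` is the one for which the `σ`-slope of `T` itself equals `q'`. -/
theorem sigmaSlope_eq (hr₁ : 0 < T.r₁)
    (hσ : σ = ((T.r₁ + T.r₂) / T.r₁) • (q' - (1 / (T.r₁ + T.r₂)) • (T.P₁ + T.P₂))) :
    T.sigmaSlope σ = q' := by
  have hr := T.r₂_nonneg
  have : T.r₁ + T.r₂ ≠ 0 := by positivity
  rw [sigmaSlope, sigmaPoly, hσ]
  match_scalars <;> field_simp <;> ring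

/-- `Θ_{q'}(T')` is the `σ`-slope of `T'` minus `q'`. No ranks need to be nonzero: where one is,
the conventional quotients by `0` agree on both sides. -/
theorem Θ_eq
    (hσ : σ = ((T.r₁ + T.r₂) / T.r₁) • (q' - (1 / (T.r₁ + T.r₂)) • (T.P₁ + T.P₂)))
    (T' : Triple X) : T.Θ q' T' = T'.sigmaSlope σ - q' := by
  rw [Θ, sigmaSlope, sigmaPoly, hσ]
  module

/-- The polynomial whose sign defines `q`-stability is a positive multiple of
`q * (μ_σ(T') - q')`. -/
theorem qStability_eq (hr₁ : 0 < T.r₁) (hr₂ : 0 < T.r₂) {q : ℚ[X]}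
    (hσ : σ = ((T.r₁ + T.r₂) / T.r₁) • (q' - (1 / (T.r₁ + T.r₂)) • (T.P₁ + T.P₂)))
    (hq' : q' = (1 / T.r₂) • (T.P₂ + q)) {T' : Triple X} (hT' : 0 < T'.r₁ + T'.r₂) :
    T.r₂ • q * (T.r₁ • T'.P₁ - T'.r₁ • T.P₁ + T'.r₁ • q) +
        T.r₁ • q * (T.r₂ • T'.P₂ - T'.r₂ • T.P₂ - T'.r₂ • q) =
      (T.r₁ * T.r₂ * (T'.r₁ + T'.r₂)) • (q * (T'.sigmaSlope σ - q')) := by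
  refine Polynomial.funext fun x ↦ ?_
  subst hq' hσ
  simp only [sigmaSlope, sigmaPoly, eval_add, eval_sub, eval_mul, eval_smul, smul_eq_mul]
  field_simp
  ring

end Triple
end HolomorphicTriples

theorem proposition4p4 (X : HolomorphicTriples.PolarizedSurface)
    (T : HolomorphicTriples.Triple X) (hT : T.TorsionFree) (hr₁ : 0 < T.r₁)
    (q' σ : ℚ[X])
    (hσ : σ = ((T.r₁ + T.r₂) / T.r₁) • (q' - (1 / (T.r₁ + T.r₂)) • (T.P₁ + T.P₂))) :
    (T.IsQPrimeStable q' ↔ T.IsSigmaStable σ) ∧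
      (0 < T.r₂ → ∀ q : ℚ[X], 0 < q.leadingCoeff → q' = (1 / T.r₂) • (T.P₂ + q) →
        (T.IsQStable q q ↔ T.IsSigmaStable σ)) := by
  refine ⟨forall₂_congr fun A hA ↦ ?_, fun hr₂ q hq hq' ↦ forall₂_congr fun A hA ↦ ?_⟩
  · rw [HolomorphicTriples.Triple.Θ_eq hσ, HolomorphicTriples.polyLT_sub_zero_iff,
      HolomorphicTriples.Triple.sigmaSlope_eq hr₁ hσ]
  · have hpos := A.rank_pos hT hA
    rw [HolomorphicTriples.Triple.qStability_eq hr₁ hr₂ hσ hq' hpos,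
      HolomorphicTriples.polyLT_smul_mul_zero_iff (by positivity) hq,
      HolomorphicTriples.polyLT_sub_zero_iff,
      HolomorphicTriples.Triple.sigmaSlope_eq hr₁ hσ]
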